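/- **Setting.** Let $O$ (observations) and $A$ (actions) be countable sets and let $H\ge 0$ be an integer. A state at step $t$ is a history $h_t=o_1a_1\cdots o_{t-1}a_{t-1}o_t$. A discrete tree MDP is given by probabilities $P(\cdot\mid h,a)$ on $O$ for every state $h$ and action $a$, together with an initial distribution $\mu$ on $O$: one has $s_1=o_1\sim\mu$, and from the state $h$ under the action $a$ the next state is $hao$ with probability $P(o\mid h,a)$. There is no discounting ($\gamma=1$), and the only reward is $R(h_{H+1})$, received at the end, where $R$ is a fixed, bounded, deterministic function of the final history $h_{H+1}=o_1a_1\cdots o_Ha_Ho_{H+1}$ (boundedness is automatic if $O$ and $A$ are finite). A policy $\pi$ assigns to each state $h$ a distribution $\pi(\cdot\mid h)$ on $A$. Write $v^{\pi,H}$ for the expectation of $R(h_{H+1})$ when actions are drawn from $\pi$. Fix a behavior policy $\pi_0$ and a target policy $\pi_1$. An *unbiased off-policy value estimator* is a real function $X$ of one trajectory $h_{H+1}$ (it may depend on the known $\pi_0,\pi_1,R$) such that for **all** choices of $(\mu,P)$ the expectation of $X$ under $(\mu,P,\pi_0)$ exists and equals the value $v^{\pi_1,H}$ of $\pi_1$ in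 the same MDP. **Theorem 2.** For every unbiased off-policy value estimator $X$ and every choice of $(\mu,P)$, $$\operatorname{Var}(X)\;\ge\;\sum_{t=1}^{H+1}\mathbb E\Big[\rho_{1:t-1}^2\,\operatorname{Var}_t\big(V(s_t)\big)\Big],$$ where $\operatorname{Var}$ and $\mathbb E$ are taken over trajectories generated by $(\mu,P,\pi_0)$, $\rho_{1:k}=\prod_{i=1}^{k}\pi_1(a_i\mid s_i)/\pi_0(a_i\mid s_i)$, $\operatorname{Var}_t$ is the variance conditional on $o_1,a_1,\dots,o_{t-1},a_{t-1}$, and $V(s_t)$ is the expectation of $R(h_{H+1})$ when one starts in $s_t$ and follows $\pi_1$ for the remaining $H+1-t$ steps (so $V(s_{H+1})=R(h_{H+1})$). Both sides may be $+\infty$; in particular, if the right-hand side is infinite, no unbiased estimator has finite variance at $(\mu,P)$. -/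

import Mathlib

open MeasureTheory ProbabilityTheory
open scoped ENNReal

/-- A state of a tree MDP with observations `O` and actions `A`: a history
`h_t = o_1 a_1 ⋯ o_{t-1} a_{t-1} o_t`. The field `past` is the list
`[(o_1, a_1), …, (o_{t-1}, a_{t-1})]` (oldest pair first) and `obs` is the last observation. -/
@[ext] structure TreeState (O A : Type*) where
  past : List (O × A)
  obs : O

/-- States are discrete: every set of states is measurable. -/
instance TreeState.instMeasurableSpace (O A : Type*) : MeasurableSpace (TreeState O A) := ⊤

/-- The history `h a`, i.e. the state `h` followed by the action `a`. -/
def TreeState.act {O A : Type*} (h : TreeState O A) (a : A) : List (O × A) :=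
  h.past ++ [(h.obs, a)]

/-- The transition probabilities `P(o | h, a)` of a discrete tree MDP, indexed by the
action-terminated history `ha = o_1 a_1 ⋯ o_t a_t`. The value at the empty history is the
initial observation distribution `μ`, that is, `P(o | ∅) = μ(o)`. -/
abbrev TreeTransition (O A : Type*) := List (O × A) → PMF O

/-- A policy assigns to every state (= history) a distribution over actions. -/
abbrev TreePolicy (O A : Type*) := TreeState O A → PMF A

namespace TreeMDP

variable {O A : Type*}

/-- The distribution of the next state `h a o`, `o ∼ P(· | h, a)`, given the
action-terminated history `ha`. At the empty history it is the law of the initial state. -/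
noncomputable def nextState (P : TreeTransition O A) (ha : List (O × A)) :
    PMF (TreeState O A) :=
  (P ha).map fun o => ⟨ha, o⟩

/-- The distribution of the state reached from the state `h` after `n` further steps in which
actions are drawn from `π`. -/
noncomputable def rollout (P : TreeTransition O A) (π : TreePolicy O A) :
    ℕ → TreeState O A → PMF (TreeState O A)
  | 0, h => PMF.pure h
  | n + 1, h => (π h).bind fun a => (nextState P (h.act a)).bind fun h' => rollout P π n h'

/-- The distribution under `(μ, π)` of an `H`-step trajectory
`h_{H+1} = o_1 a_1 ⋯ o_H a_H o_{H+1}`. Since all rewards are determined by `h_{H+1}`,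
this is the whole trajectory. -/
noncomputable def trajLaw (P : TreeTransition O A) (π : TreePolicy O A) (H : ℕ) :
    PMF (TreeState O A) :=
  (nextState P []).bind (rollout P π H)

/-- The value `v^{π,H}`: the expected (undiscounted) return of an `H`-step trajectory, the only
reward being the final one, `R(h_{H+1})`. -/
noncomputable def value (P : TreeTransition O A) (π : TreePolicy O A) (R : TreeState O A → ℝ)
    (H : ℕ) : ℝ :=
  ∫ τ, R τ ∂(trajLaw P π H).toMeasure

/-- The state value function with `n` remaining steps: the expected final reward when starting
in state `h`. With no remaining steps it is `R h`. -/
noncomputable def stateValue (P : TreeTransition O A) (π : TreePolicy O A)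
    (R : TreeState O A → ℝ) (n : ℕ) (h : TreeState O A) : ℝ :=
  ∫ τ, R τ ∂(rollout P π n h).toMeasure

/-- The cumulative importance ratio `ρ_{1:k} = ∏_{i ≤ k} π₁(a_i | h_i) / π₀(a_i | h_i)` of an
action-terminated history `o_1 a_1 ⋯ o_k a_k`, where `h_i = o_1 a_1 ⋯ o_i`. -/
noncomputable def cumRatio (π₀ π₁ : TreePolicy O A) (ha : List (O × A)) : ℝ :=
  ∏ i : Fin ha.length,
    (π₁ ⟨ha.take i, (ha.get i).1⟩ (ha.get i).2).toReal /
      (π₀ ⟨ha.take i, (ha.get i).1⟩ (ha.get i).2).toReal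

/-- `Var_t(V(s_t))` on the trajectory `τ`: the variance of the value of the state `s_t`, with
`H + 1 - t` steps remaining, conditionally on `o_1, a_1, …, o_{t-1}, a_{t-1}`. Given this
history, the law of `s_t` is `nextState`. -/
noncomputable def condVarValue (P : TreeTransition O A) (π : TreePolicy O A)
    (R : TreeState O A → ℝ) (H t : ℕ) (τ : TreeState O A) : ℝ :=
  variance (stateValue P π R (H + 1 - t)) (nextState P (τ.past.take (t - 1))).toMeasure

/-- `X`, a function of one trajectory drawn with the behavior policy `π₀`, is an unbiased
estimator of the value of the target policy `π₁`: whatever the transition probabilities are, its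
expectation exists and is that value. -/
def IsUnbiased (π₀ π₁ : TreePolicy O A) (R : TreeState O A → ℝ) (H : ℕ)
    (X : TreeState O A → ℝ) : Prop :=
  ∀ P : TreeTransition O A,
    Integrable X (trajLaw P π₀ H).toMeasure ∧
      ∫ τ, X τ ∂(trajLaw P π₀ H).toMeasure = value P π₁ R H

end TreeMDP

namespace PMF

section Bind

variable {α β : Type*}

theorem ae_toMeasure_iff [MeasurableSpace α] [DiscreteMeasurableSpace α] (p : PMF α)
    {q : α → Prop} : (∀ᵐ x ∂p.toMeasure, q x) ↔ ∀ x ∈ p.support, q x := by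
  rw [ae_iff, p.toMeasure_apply_eq_zero_iff (MeasurableSet.of_discrete), Set.disjoint_left]
  simp

variable [MeasurableSpace α] [DiscreteMeasurableSpace α] [Countable α]
  [MeasurableSpace β]

/-- A family of probability mass functions indexed by a countable type, as a kernel. -/
noncomputable def toKernel (f : α → PMF β) : Kernel α β :=
  ⟨fun a => (f a).toMeasure, measurable_of_countable _⟩

theorem toKernel_apply (f : α → PMF β) (a : α) : toKernel f a = (f a).toMeasure := rfl

theorem toMeasure_bind (p : PMF α) (f : α → PMF β) :
    (p.bind f).toMeasure = p.toMeasure.bind (toKernel f) := by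
  ext s hs
  rw [toMeasure_bind_apply _ _ _ hs, Measure.bind_apply hs (toKernel f).measurable.aemeasurable,
    lintegral_countable']
  refine tsum_congr fun a => ?_
  rw [toMeasure_apply_singleton _ _ (measurableSet_singleton a), mul_comm, toKernel_apply]

theorem lintegral_bind [DiscreteMeasurableSpace β] (p : PMF α) (f : α → PMF β) (g : β → ℝ≥0∞) :
    ∫⁻ y, g y ∂(p.bind f).toMeasure = ∫⁻ x, ∫⁻ y, g y ∂(f x).toMeasure ∂p.toMeasure := by
  rw [toMeasure_bind, Measure.lintegral_bind (toKernel f).measurable.aemeasurable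
    (Measurable.of_discrete).aemeasurable]
  rfl

variable {p : PMF α} {f : α → PMF β} {g : β → ℝ}

theorem integrable_of_bind (hg : Integrable g (p.bind f).toMeasure) :
    ∀ x ∈ p.support, Integrable g (f x).toMeasure := by
  rw [toMeasure_bind] at hg
  exact (ae_toMeasure_iff p).1 ((Measure.integrable_comp_iff hg.1).1 hg).1

theorem integrable_integral_of_bind (hg : Integrable g (p.bind f).toMeasure) :
    Integrable (fun x => ∫ y, g y ∂(f x).toMeasure) p.toMeasure := by
  rw [toMeasure_bind, Measure.comp_eq_comp_const_apply] at hg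
  have h := Integrable.integral_comp hg
  rw [Kernel.const_apply] at h
  exact h

theorem integral_bind (hg : Integrable g (p.bind f).toMeasure) :
    ∫ y, g y ∂(p.bind f).toMeasure = ∫ x, ∫ y, g y ∂(f x).toMeasure ∂p.toMeasure := by
  rw [toMeasure_bind, Measure.comp_eq_comp_const_apply] at hg ⊢
  rw [Kernel.integral_comp hg, Kernel.const_apply]
  rfl

end Bind

end PMF

namespace ProbabilityTheory

/-- The second moment about `c` is the variance plus the squared bias. -/
theorem lintegral_enorm_sub_sq {Ω : Type*} [MeasurableSpace Ω] {μ : Measure Ω}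
    [IsProbabilityMeasure μ] {X : Ω → ℝ} (hX : Integrable X μ) (c : ℝ) :
    ∫⁻ ω, ‖X ω - c‖ₑ ^ 2 ∂μ = evariance X μ + ‖(∫ ω, X ω ∂μ) - c‖ₑ ^ 2 := by
  have key : evariance (fun ω => X ω - c) μ = evariance X μ := by
    unfold evariance
    rw [integral_sub hX (integrable_const c)]
    simp
  by_cases h2 : MemLp X 2 μ
  · have h2' : MemLp (fun ω => X ω - c) 2 μ := h2.sub (memLp_const c)
    have h3 : ∫⁻ ω, ‖X ω - c‖ₑ ^ 2 ∂μ = ENNReal.ofReal (∫ ω, (X ω - c) ^ 2 ∂μ) := by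
      rw [ofReal_integral_eq_lintegral_ofReal h2'.integrable_sq
        (Filter.Eventually.of_forall fun _ => sq_nonneg _)]
      refine lintegral_congr fun ω => ?_
      rw [← enorm_pow, Real.enorm_of_nonneg (sq_nonneg _)]
    have h4 := variance_eq_sub h2'
    have h5 : ∫ ω, (X ω - c) ∂μ = (∫ ω, X ω ∂μ) - c := by
      rw [integral_sub hX (integrable_const c)]; simp
    simp only [Pi.pow_apply] at h4
    rw [h3, ← key, ← ofReal_variance h2', ← enorm_pow, Real.enorm_of_nonneg (sq_nonneg _),
      ← ENNReal.ofReal_add (variance_nonneg _ _) (sq_nonneg _), h4, h5]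
    congr 1
    ring
  · have h2' : ¬ MemLp (fun ω => X ω - c) 2 μ := fun h =>
      h2 (by simpa [Pi.add_def] using h.add (memLp_const c))
    rw [evariance_eq_top hX.1 h2, top_add]
    by_contra hne
    refine h2' ⟨by fun_prop, ?_⟩
    rw [eLpNorm_lt_top_iff_lintegral_rpow_enorm_lt_top two_ne_zero ENNReal.ofNat_ne_top]
    simpa [lt_top_iff_ne_top] using hne

/-- The law of total variance for the composition of discrete distributions. -/
theorem evariance_bind {α β : Type*} [MeasurableSpace α] [DiscreteMeasurableSpace α] [Countable α]
    [MeasurableSpace β] [DiscreteMeasurableSpace β] {p : PMF α} {f : α → PMF β} {g : β → ℝ}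
    (hg : Integrable g (p.bind f).toMeasure) :
    evariance g (p.bind f).toMeasure
      = (∫⁻ x, evariance g (f x).toMeasure ∂p.toMeasure)
        + evariance (fun x => ∫ y, g y ∂(f x).toMeasure) p.toMeasure := by
  rw [evariance, PMF.lintegral_bind, evariance.eq_1 _ p.toMeasure, ← lintegral_add_left .of_discrete,
    ← PMF.integral_bind hg]
  refine lintegral_congr_ae ((PMF.ae_toMeasure_iff p).2 fun x hx => ?_)
  exact lintegral_enorm_sub_sq (PMF.integrable_of_bind hg x hx) _

/-- The variance of an affine image is at most the extended variance of any function that agrees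
with it almost surely. -/
theorem ofReal_mul_variance_le_evariance {Ω : Type*} [MeasurableSpace Ω] {μ : Measure Ω}
    [IsProbabilityMeasure μ] {V W : Ω → ℝ} (hV : AEStronglyMeasurable V μ) (ρ c : ℝ)
    (h : ∀ᵐ ω ∂μ, W ω = ρ * V ω + c) :
    ENNReal.ofReal (ρ ^ 2 * variance V μ) ≤ evariance W μ := by
  rw [← variance_const_mul, ← variance_add_const (hV.const_mul ρ) c, ← variance_congr h]
  exact ENNReal.ofReal_toReal_le

end ProbabilityTheory

namespace TreeState

variable {O A : Type*}

instance : DiscreteMeasurableSpace (TreeState O A) := ⟨fun _ => trivial⟩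

instance [Countable O] [Countable A] : Countable (TreeState O A) :=
  Function.Injective.countable (f := fun h : TreeState O A => (h.past, h.obs)) fun h h' heq => by
    simp only [Prod.mk.injEq] at heq
    exact TreeState.ext heq.1 heq.2

end TreeState

namespace TreeMDP

variable {O A : Type*}

theorem mem_support_nextState {P : TreeTransition O A} {l : List (O × A)} {h : TreeState O A} :
    h ∈ (nextState P l).support ↔ h.past = l ∧ h.obs ∈ (P l).support := by
  simp only [nextState, PMF.mem_support_map_iff]
  constructor
  · rintro ⟨o, ho, rfl⟩
    exact ⟨rfl, ho⟩
  · rintro ⟨rfl, ho⟩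
    exact ⟨h.obs, ho, rfl⟩

theorem lintegral_nextState_past (P : TreeTransition O A) (l : List (O × A))
    (g : List (O × A) → ℝ≥0∞) : ∫⁻ s, g s.past ∂(nextState P l).toMeasure = g l := by
  rw [lintegral_congr_ae (g := fun _ => g l)]
  · simp
  · exact (PMF.ae_toMeasure_iff _).2 fun s hs => congrArg g (mem_support_nextState.1 hs).1

theorem nextState_apply_self (P : TreeTransition O A) (h : TreeState O A) :
    nextState P h.past h = P h.past h.obs := by
  rw [nextState, PMF.map_apply, tsum_eq_single h.obs]
  · simp
  · intro o ho
    rw [if_neg]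
    exact fun h' => ho (congrArg TreeState.obs h').symm

/-- The law of the state following `h` when the action is drawn from `π`. -/
noncomputable def step (P : TreeTransition O A) (π : TreePolicy O A) (h : TreeState O A) :
    PMF (TreeState O A) :=
  (π h).bind fun a => nextState P (h.act a)

theorem rollout_succ (P : TreeTransition O A) (π : TreePolicy O A) (n : ℕ) (h : TreeState O A) :
    rollout P π (n + 1) h = (step P π h).bind (rollout P π n) := by
  rw [rollout, step, PMF.bind_bind]

theorem rollout_add (P : TreeTransition O A) (π : TreePolicy O A) (m n : ℕ) (h : TreeState O A) :
    rollout P π (m + n) h = (rollout P π m h).bind (rollout P π n) := by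
  induction m generalizing h with
  | zero => simp [rollout]
  | succ m ih =>
    rw [Nat.succ_add, rollout_succ, rollout_succ, PMF.bind_bind]
    exact congrArg _ (funext ih)

theorem trajLaw_zero (P : TreeTransition O A) (π : TreePolicy O A) :
    trajLaw P π 0 = nextState P [] := by
  simp only [trajLaw]
  exact PMF.bind_pure _

theorem trajLaw_add (P : TreeTransition O A) (π : TreePolicy O A) (m n : ℕ) :
    trajLaw P π (m + n) = (trajLaw P π m).bind (rollout P π n) := by
  rw [trajLaw, trajLaw, PMF.bind_bind]
  exact congrArg _ (funext fun h => rollout_add P π m n h)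

theorem trajLaw_succ (P : TreeTransition O A) (π : TreePolicy O A) (n : ℕ) :
    trajLaw P π (n + 1) = (trajLaw P π n).bind (step P π) := by
  rw [trajLaw_add]
  congr 1
  funext h
  rw [rollout_succ]
  exact PMF.bind_pure _

theorem past_of_mem_support_rollout {P : TreeTransition O A} {π : TreePolicy O A} {n : ℕ}
    {h τ : TreeState O A} (hτ : τ ∈ (rollout P π n h).support) :
    ∃ l, τ.past = h.past ++ l ∧ l.length = n := by
  induction n generalizing h with
  | zero =>
    obtain rfl : τ = h := by simpa [rollout] using hτ
    exact ⟨[], by simp⟩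
  | succ n ih =>
    simp only [rollout, PMF.mem_support_bind_iff, mem_support_nextState] at hτ
    obtain ⟨a, -, h', ⟨hpast, -⟩, hτ⟩ := hτ
    obtain ⟨l, hl, hlen⟩ := ih hτ
    exact ⟨(h.obs, a) :: l, by simp [hl, hpast, TreeState.act], by simp [hlen]⟩

theorem length_past_of_mem_support_trajLaw {P : TreeTransition O A} {π : TreePolicy O A} {n : ℕ}
    {τ : TreeState O A} (hτ : τ ∈ (trajLaw P π n).support) : τ.past.length = n := by
  simp only [trajLaw, PMF.mem_support_bind_iff, mem_support_nextState] at hτ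
  obtain ⟨h, ⟨hpast, -⟩, hτ⟩ := hτ
  obtain ⟨l, hl, hlen⟩ := past_of_mem_support_rollout hτ
  simp [hl, hpast, hlen]

theorem nextState_congr {P P' : TreeTransition O A} {l : List (O × A)} (h : P l = P' l) :
    nextState P l = nextState P' l := by
  rw [nextState, nextState, h]

theorem rollout_congr {P P' : TreeTransition O A} (π : TreePolicy O A) {n : ℕ}
    {h : TreeState O A}
    (hP : ∀ l, h.past.length < l.length → l.length ≤ h.past.length + n → P l = P' l) :
    rollout P π n h = rollout P' π n h := by
  induction n generalizing h with
  | zero => rfl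
  | succ n ih =>
    rw [rollout, rollout]
    congr 1
    funext a
    rw [nextState_congr (hP (h.act a) (by simp [TreeState.act]) (by simp [TreeState.act]))]
    simp only [nextState, PMF.bind_map]
    congr 1
    funext o
    refine ih fun l h₁ h₂ => hP l ?_ ?_ <;> simp [TreeState.act] at h₁ h₂ ⊢ <;> omega

theorem trajLaw_congr {P P' : TreeTransition O A} (π : TreePolicy O A) {n : ℕ}
    (hP : ∀ l, l.length ≤ n → P l = P' l) : trajLaw P π n = trajLaw P' π n := by
  rw [trajLaw, trajLaw, nextState_congr (hP [] (by simp))]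
  simp only [nextState, PMF.bind_map]
  congr 1
  funext o
  exact rollout_congr π fun l _ h₂ => hP l (by simpa using h₂)

/-- The law of the action-terminated history `o_1 a_1 ⋯ o_k a_k`. -/
noncomputable def prefixLaw (P : TreeTransition O A) (π : TreePolicy O A) :
    ℕ → PMF (List (O × A))
  | 0 => PMF.pure []
  | k + 1 => (trajLaw P π k).bind fun h => (π h).map h.act

theorem trajLaw_eq_prefixLaw_bind (P : TreeTransition O A) (π : TreePolicy O A) (k : ℕ) :
    trajLaw P π k = (prefixLaw P π k).bind (nextState P) := by
  cases k with
  | zero => rw [trajLaw_zero, prefixLaw, PMF.pure_bind]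
  | succ k =>
    rw [trajLaw_succ, prefixLaw, PMF.bind_bind]
    congr 1
    funext h
    rw [PMF.bind_map]
    rfl

theorem prefixLaw_congr {P P' : TreeTransition O A} (π : TreePolicy O A) {k : ℕ}
    (hP : ∀ l, l.length < k → P l = P' l) : prefixLaw P π k = prefixLaw P' π k := by
  cases k with
  | zero => rfl
  | succ k => rw [prefixLaw, prefixLaw, trajLaw_congr π fun l hl => hP l (by omega)]

theorem length_of_mem_support_prefixLaw {P : TreeTransition O A} {π : TreePolicy O A} {k : ℕ}
    {l : List (O × A)} (hl : l ∈ (prefixLaw P π k).support) : l.length = k := by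
  cases k with
  | zero => simpa [prefixLaw] using hl
  | succ k =>
    simp only [prefixLaw, PMF.mem_support_bind_iff, PMF.mem_support_map_iff] at hl
    obtain ⟨h, hh, a, -, rfl⟩ := hl
    simp [TreeState.act, length_past_of_mem_support_trajLaw hh]

theorem past_mem_support_prefixLaw {P : TreeTransition O A} {π : TreePolicy O A} {k : ℕ}
    {h : TreeState O A} (hh : h ∈ (trajLaw P π k).support) :
    h.past ∈ (prefixLaw P π k).support := by
  rw [trajLaw_eq_prefixLaw_bind] at hh
  simp only [PMF.mem_support_bind_iff, mem_support_nextState] at hh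
  obtain ⟨l, hl, rfl, -⟩ := hh
  exact hl

theorem trajLaw_apply (P : TreeTransition O A) (π : TreePolicy O A) (k : ℕ) (h : TreeState O A) :
    trajLaw P π k h = prefixLaw P π k h.past * P h.past h.obs := by
  rw [trajLaw_eq_prefixLaw_bind, PMF.bind_apply, tsum_eq_single h.past, nextState_apply_self]
  intro l hl
  rw [(PMF.apply_eq_zero_iff (nextState P l) h).2, mul_zero]
  exact fun hh => hl (mem_support_nextState.1 hh).1.symm

theorem prefixLaw_succ_act (P : TreeTransition O A) (π : TreePolicy O A) (k : ℕ)
    (h : TreeState O A) (a : A) :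
    prefixLaw P π (k + 1) (h.act a) = trajLaw P π k h * π h a := by
  rw [prefixLaw, PMF.bind_apply, tsum_eq_single h]
  · rw [PMF.map_apply, tsum_eq_single a]
    · simp
    · intro b hb
      rw [if_neg]
      simpa [TreeState.act] using hb.symm
  · intro h' hh'
    rw [(PMF.apply_eq_zero_iff ((π h').map h'.act) (h.act a)).2, mul_zero]
    simp only [PMF.mem_support_map_iff, not_exists, not_and]
    rintro b - hb
    refine hh' ?_
    simp only [TreeState.act] at hb
    have := List.append_inj' hb rfl
    simp only [List.cons.injEq, Prod.mk.injEq] at this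
    exact TreeState.ext this.1 this.2.1.1

theorem cumRatio_nil (π₀ π₁ : TreePolicy O A) : cumRatio π₀ π₁ [] = 1 := by
  simp [cumRatio]

theorem cumRatio_act (π₀ π₁ : TreePolicy O A) (h : TreeState O A) (a : A) :
    cumRatio π₀ π₁ (h.act a)
      = cumRatio π₀ π₁ h.past * ((π₁ h a).toReal / (π₀ h a).toReal) := by
  have hlen : h.past.length + 1 = (h.act a).length := by simp [TreeState.act]
  rw [cumRatio, ← (finCongr hlen).prod_comp, Fin.prod_univ_castSucc, cumRatio]
  have hval : ∀ i, ((finCongr hlen i : Fin _) : ℕ) = i := fun _ => rfl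
  simp only [List.get_eq_getElem, hval, Fin.val_castSucc, Fin.val_last]
  congr 1
  · refine Finset.prod_congr rfl fun i _ => ?_
    simp [TreeState.act, List.take_append_of_le_length i.2.le]
  · simp [TreeState.act]

/-- Where the behavior policy has positive probability, the cumulative importance ratio is the
density of the target prefix law with respect to the behavior prefix law. -/
theorem toReal_prefixLaw_eq_cumRatio_mul (P : TreeTransition O A) (π₀ π₁ : TreePolicy O A) {k : ℕ}
    {l : List (O × A)} (hl : l ∈ (prefixLaw P π₀ k).support) :
    (prefixLaw P π₁ k l).toReal = cumRatio π₀ π₁ l * (prefixLaw P π₀ k l).toReal := by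
  induction k generalizing l with
  | zero =>
    obtain rfl : l = [] := by simpa [prefixLaw] using hl
    simp [prefixLaw, cumRatio_nil]
  | succ k ih =>
    have hl' := hl
    simp only [prefixLaw, PMF.mem_support_bind_iff, PMF.mem_support_map_iff] at hl'
    obtain ⟨h, hh, a, ha, rfl⟩ := hl'
    have hne : (π₀ h a).toReal ≠ 0 :=
      ENNReal.toReal_ne_zero.2 ⟨(PMF.mem_support_iff _ _).1 ha, PMF.apply_ne_top _ _⟩
    rw [prefixLaw_succ_act, prefixLaw_succ_act, trajLaw_apply, trajLaw_apply, cumRatio_act]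
    simp only [ENNReal.toReal_mul]
    rw [ih (past_mem_support_prefixLaw hh)]
    field_simp


variable [Countable O] [Countable A]

/-- Bounded rewards are integrable under every trajectory law. -/
theorem integrable_trajLaw_of_bounded {R : TreeState O A → ℝ} {H : ℕ}
    (hR : ∃ C : ℝ, ∀ h : TreeState O A, h.past.length = H → |R h| ≤ C)
    (P : TreeTransition O A) (π : TreePolicy O A) : Integrable R (trajLaw P π H).toMeasure := by
  obtain ⟨C, hC⟩ := hR
  refine Integrable.of_bound .of_discrete C ((PMF.ae_toMeasure_iff _).2 fun h hh => ?_)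
  exact hC h (length_past_of_mem_support_trajLaw hh)

open Classical in
/-- Two deterministic perturbations of the transition at one history `l` change an expectation
by the probability of `l` times the difference of the two continuation values. -/
theorem integral_trajLaw_update_sub (P : TreeTransition O A) (π : TreePolicy O A) {H : ℕ}
    {f : TreeState O A → ℝ}
    (hf : ∀ P' : TreeTransition O A, Integrable f (trajLaw P' π H).toMeasure)
    {l : List (O × A)} (hl : l.length ≤ H) (o o' : O) :
    ∫ τ, f τ ∂(trajLaw (Function.update P l (PMF.pure o)) π H).toMeasure
        - ∫ τ, f τ ∂(trajLaw (Function.update P l (PMF.pure o')) π H).toMeasure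
      = (prefixLaw P π l.length l).toReal *
        (∫ τ, f τ ∂(rollout P π (H - l.length) ⟨l, o⟩).toMeasure
          - ∫ τ, f τ ∂(rollout P π (H - l.length) ⟨l, o'⟩).toMeasure) := by
  let _ : MeasurableSpace (List (O × A)) := ⊤
  have : DiscreteMeasurableSpace (List (O × A)) := ⟨fun _ => trivial⟩
  set Q : O → TreeTransition O A := fun x => Function.update P l (PMF.pure x) with hQ
  let g : O → List (O × A) → PMF (TreeState O A) := fun x l' =>
    (nextState (Q x) l').bind (rollout (Q x) π (H - l.length))
  have hQne : ∀ x l', l' ≠ l → Q x l' = P l' := fun x l' h => Function.update_of_ne h _ _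
  have hroll : ∀ x l' y, l'.length = l.length →
      rollout (Q x) π (H - l.length) ⟨l', y⟩ = rollout P π (H - l.length) ⟨l', y⟩ := by
    intro x l' y hl'
    refine rollout_congr π fun m hm _ => hQne x m ?_
    rintro rfl
    exact absurd hm (by simp [hl'])
  have hlaw : ∀ x, trajLaw (Q x) π H = (prefixLaw P π l.length).bind (g x) := by
    intro x
    have hpre : prefixLaw (Q x) π l.length = prefixLaw P π l.length := by
      refine prefixLaw_congr π fun m hm => hQne x m ?_
      rintro rfl
      exact absurd hm (lt_irrefl _)
    conv_lhs => rw [← Nat.add_sub_cancel' hl]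
    rw [trajLaw_add, trajLaw_eq_prefixLaw_bind, PMF.bind_bind, hpre]
  have hself : ∀ x, g x l = rollout P π (H - l.length) ⟨l, x⟩ := by
    intro x
    simp only [g, nextState, hQ, Function.update_self, PMF.pure_map, PMF.pure_bind]
    exact hroll x l x rfl
  have hother : ∀ x l', l'.length = l.length → l' ≠ l →
      g x l' = (nextState P l').bind (rollout P π (H - l.length)) := by
    intro x l' hlen hne
    simp only [g, nextState_congr (hQne x l' hne)]
    simp only [nextState, PMF.bind_map]
    congr 1
    funext y
    exact hroll x l' y hlen
  have hint : ∀ x, Integrable f ((prefixLaw P π l.length).bind (g x)).toMeasure := fun x =>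
    hlaw x ▸ hf (Q x)
  change ∫ τ, f τ ∂(trajLaw (Q o) π H).toMeasure - ∫ τ, f τ ∂(trajLaw (Q o') π H).toMeasure = _
  rw [hlaw, hlaw, PMF.integral_bind (hint o), PMF.integral_bind (hint o'),
    ← integral_sub (PMF.integrable_integral_of_bind (hint o))
      (PMF.integrable_integral_of_bind (hint o')), ← hself, ← hself]
  rw [integral_congr_ae (g := Set.indicator {l} fun _ =>
    ∫ τ, f τ ∂(g o l).toMeasure - ∫ τ, f τ ∂(g o' l).toMeasure)]
  · rw [integral_indicator_const _ (measurableSet_singleton l), measureReal_def,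
      PMF.toMeasure_apply_singleton _ _ (measurableSet_singleton l), smul_eq_mul]
  · refine (PMF.ae_toMeasure_iff _).2 fun l' hl' => ?_
    by_cases h : l' = l
    · subst h
      simp
    · have hlen := length_of_mem_support_prefixLaw hl'
      simp only [hother _ l' hlen h, sub_self]
      rw [Set.indicator_of_notMem (by simpa using h)]

/-- On reachable histories, the continuation values of an unbiased estimator and of the target
policy have proportional increments in the last observation. -/
theorem IsUnbiased.stateValue_sub {π₀ π₁ : TreePolicy O A} {R X : TreeState O A → ℝ} {H : ℕ}
    (hX : IsUnbiased π₀ π₁ R H X)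
    (hR : ∃ C : ℝ, ∀ h : TreeState O A, h.past.length = H → |R h| ≤ C)
    (P : TreeTransition O A) {l : List (O × A)} (hl : l.length ≤ H)
    (hmem : l ∈ (prefixLaw P π₀ l.length).support) (o o' : O) :
    stateValue P π₀ X (H - l.length) ⟨l, o⟩ - stateValue P π₀ X (H - l.length) ⟨l, o'⟩
      = cumRatio π₀ π₁ l *
        (stateValue P π₁ R (H - l.length) ⟨l, o⟩ - stateValue P π₁ R (H - l.length) ⟨l, o'⟩) := by
  classical
  have h₀ := integral_trajLaw_update_sub P π₀ (fun P' => (hX P').1) hl o o'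
  have h₁ := integral_trajLaw_update_sub P π₁
    (fun P' => integrable_trajLaw_of_bounded hR P' π₁) hl o o'
  rw [(hX _).2, (hX _).2, value, value, h₁, toReal_prefixLaw_eq_cumRatio_mul P π₀ π₁ hmem] at h₀
  have hne : (prefixLaw P π₀ l.length l).toReal ≠ 0 :=
    ENNReal.toReal_ne_zero.2 ⟨(PMF.mem_support_iff _ _).1 hmem, PMF.apply_ne_top _ _⟩
  simp only [stateValue]
  apply mul_left_cancel₀ hne
  rw [← h₀]
  ring

/-- The conditional variance of the target value, weighted by the squared importance ratio, is at
most the conditional variance of the continuation value of an unbiased estimator. -/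
theorem IsUnbiased.ofReal_mul_variance_le {π₀ π₁ : TreePolicy O A} {R X : TreeState O A → ℝ}
    {H : ℕ} (hX : IsUnbiased π₀ π₁ R H X)
    (hR : ∃ C : ℝ, ∀ h : TreeState O A, h.past.length = H → |R h| ≤ C)
    (P : TreeTransition O A) {l : List (O × A)} (hl : l.length ≤ H)
    (hmem : l ∈ (prefixLaw P π₀ l.length).support) :
    ENNReal.ofReal (cumRatio π₀ π₁ l ^ 2 *
        variance (stateValue P π₁ R (H - l.length)) (nextState P l).toMeasure)
      ≤ evariance (stateValue P π₀ X (H - l.length)) (nextState P l).toMeasure := by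
  obtain ⟨o', -⟩ := (P l).support_nonempty
  refine ofReal_mul_variance_le_evariance .of_discrete _
    (stateValue P π₀ X (H - l.length) ⟨l, o'⟩
      - cumRatio π₀ π₁ l * stateValue P π₁ R (H - l.length) ⟨l, o'⟩)
    ((PMF.ae_toMeasure_iff _).2 fun h hh => ?_)
  obtain ⟨rfl, -⟩ := mem_support_nextState.1 hh
  linear_combination hX.stateValue_sub hR P hl hmem h.obs o'

/-- The variance of `X` over one step of the tree is at least the expected remaining variance plus
the variance due to the next observation. -/
theorem lintegral_step_le_evariance_rollout {P : TreeTransition O A} {π : TreePolicy O A}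
    {X : TreeState O A → ℝ} {n : ℕ} {h : TreeState O A}
    (hX : Integrable X (rollout P π (n + 1) h).toMeasure) :
    ∫⁻ s, (evariance X (rollout P π n s).toMeasure
        + evariance (stateValue P π X n) (nextState P s.past).toMeasure) ∂(step P π h).toMeasure
      ≤ evariance X (rollout P π (n + 1) h).toMeasure := by
  let _ : MeasurableSpace A := ⊤
  have : DiscreteMeasurableSpace A := ⟨fun _ => trivial⟩
  rw [rollout] at hX ⊢
  rw [evariance_bind hX, step, PMF.lintegral_bind]
  refine le_add_right (lintegral_mono_ae ((PMF.ae_toMeasure_iff _).2 fun a ha => ?_))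
  rw [evariance_bind (PMF.integrable_of_bind hX a ha), lintegral_add_left .of_discrete]
  exact add_le_add le_rfl (lintegral_nextState_past P (h.act a) fun l =>
    evariance (stateValue P π X n) (nextState P l).toMeasure).le

/-- The variance of `X` dominates the sum of the variances due to the observations. -/
theorem sum_lintegral_evariance_le {P : TreeTransition O A} {π : TreePolicy O A}
    {X : TreeState O A → ℝ} {H : ℕ} (hX : Integrable X (trajLaw P π H).toMeasure) :
    ∑ k ∈ Finset.range (H + 1), ∫⁻ s, evariance (stateValue P π X (H - k))
        (nextState P s.past).toMeasure ∂(trajLaw P π k).toMeasure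
      ≤ evariance X (trajLaw P π H).toMeasure := by
  suffices hk : ∀ k ≤ H, ∑ j ∈ Finset.range (k + 1), ∫⁻ s, evariance (stateValue P π X (H - j))
        (nextState P s.past).toMeasure ∂(trajLaw P π j).toMeasure
      + ∫⁻ s, evariance X (rollout P π (H - k) s).toMeasure ∂(trajLaw P π k).toMeasure
      ≤ evariance X (trajLaw P π H).toMeasure from le_self_add.trans (hk H le_rfl)
  intro k
  induction k with
  | zero =>
    intro _
    rw [trajLaw.eq_1 P π H, evariance_bind hX, Finset.sum_range_one, add_comm, trajLaw_zero]
    exact add_le_add le_rfl (lintegral_nextState_past P [] fun l =>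
      evariance (stateValue P π X H) (nextState P l).toMeasure).le
  | succ k ih =>
    intro hk
    refine le_trans ?_ (ih (by omega))
    rw [Finset.sum_range_succ, add_assoc]
    refine add_le_add le_rfl ?_
    obtain ⟨n, hn⟩ : ∃ n, H - k = n + 1 := ⟨H - k - 1, by omega⟩
    rw [show H - (k + 1) = n by omega, hn, ← lintegral_add_left .of_discrete, trajLaw_succ,
      PMF.lintegral_bind]
    refine lintegral_mono_ae ((PMF.ae_toMeasure_iff _).2 fun h hh => ?_)
    have hXk : Integrable X ((trajLaw P π k).bind (rollout P π (n + 1))).toMeasure := by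
      rwa [← trajLaw_add, show k + (n + 1) = H by omega]
    refine le_trans (le_of_eq ?_)
      (lintegral_step_le_evariance_rollout (PMF.integrable_of_bind hXk h hh))
    exact lintegral_congr fun s => add_comm _ _

/-- The expectation of a function of the first `k` observation-action pairs of a trajectory. -/
theorem lintegral_trajLaw_take (P : TreeTransition O A) (π : TreePolicy O A) {k H : ℕ}
    (hk : k ≤ H) (g : List (O × A) → ℝ≥0∞) :
    ∫⁻ τ, g (τ.past.take k) ∂(trajLaw P π H).toMeasure
      = ∫⁻ s, g s.past ∂(trajLaw P π k).toMeasure := by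
  conv_lhs => rw [← Nat.add_sub_cancel' hk, trajLaw_add, PMF.lintegral_bind]
  refine lintegral_congr_ae ((PMF.ae_toMeasure_iff _).2 fun s hs => ?_)
  change ∫⁻ τ, g (τ.past.take k) ∂(rollout P π (H - k) s).toMeasure = g s.past
  rw [lintegral_congr_ae (g := fun _ => g s.past)]
  · simp
  · refine (PMF.ae_toMeasure_iff _).2 fun τ hτ => ?_
    obtain ⟨l, hl, -⟩ := past_of_mem_support_rollout hτ
    change g (τ.past.take k) = g s.past
    rw [hl, List.take_left' (length_past_of_mem_support_trajLaw hs)]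

end TreeMDP

theorem theorem2 {O A : Type*} [Countable O] [Countable A] (H : ℕ)
    (π₀ π₁ : TreePolicy O A) (R : TreeState O A → ℝ)
    (hR : ∃ C : ℝ, ∀ h : TreeState O A, h.past.length = H → |R h| ≤ C)
    (X : TreeState O A → ℝ) (hX : TreeMDP.IsUnbiased π₀ π₁ R H X)
    (P : TreeTransition O A) :
    ∑ t ∈ Finset.Icc 1 (H + 1),
        ∫⁻ τ, ENNReal.ofReal
          (TreeMDP.cumRatio π₀ π₁ (τ.past.take (t - 1)) ^ 2 *
            TreeMDP.condVarValue P π₁ R H t τ) ∂(TreeMDP.trajLaw P π₀ H).toMeasure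
      ≤ evariance X (TreeMDP.trajLaw P π₀ H).toMeasure := by
  refine le_trans ?_ (TreeMDP.sum_lintegral_evariance_le (hX P).1)
  rw [Finset.range_eq_Ico, Finset.sum_Ico_eq_sum_range, ← Finset.Ico_add_one_right_eq_Icc,
    Finset.sum_Ico_eq_sum_range]
  refine Finset.sum_le_sum fun k hk => ?_
  have hkH : k ≤ H := by
    have := Finset.mem_range.1 hk
    omega
  simp only [TreeMDP.condVarValue, show 1 + k - 1 = k by omega,
    show H + 1 - (1 + k) = H - k by omega, zero_add]
  rw [TreeMDP.lintegral_trajLaw_take P π₀ hkH fun l => ENNReal.ofReal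
    (TreeMDP.cumRatio π₀ π₁ l ^ 2 *
      variance (TreeMDP.stateValue P π₁ R (H - k)) (TreeMDP.nextState P l).toMeasure)]
  refine lintegral_mono_ae ((PMF.ae_toMeasure_iff _).2 fun s hs => ?_)
  obtain rfl := TreeMDP.length_past_of_mem_support_trajLaw hs
  exact hX.ofReal_mul_variance_le hR P hkH (TreeMDP.past_mem_support_prefixLaw hs)
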